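/- Let $A$ be a noetherian Krull domain, that is, a noetherian integral domain such that $A=\bigcap_{\mathfrak p}A_{\mathfrak p}$ (intersection in the fraction field of $A$, over all primes $\mathfrak p$ of height $1$), every such $A_{\mathfrak p}$ is a discrete valuation ring, and every nonzero $x\in A$ is a unit in $A_{\mathfrak p}$ for all but finitely many $\mathfrak p$ of height $1$. A finitely generated torsion module over such a ring is called pseudo-null if its annihilator has height at least $2$ (the unit ideal having height $\infty$), and a pseudo-isomorphism is a homomorphism with pseudo-null kernel and cokernel. The characteristic ideal $Ch_A(M)$ of a finitely generated $A$-module $M$ is $0$ if $M$ is not torsion; if $M$ is torsion, then $Ch_A(M)=\prod_{i=1}^n\mathfrak p_i^{e_i}$, where $M\to\bigoplus_{i=1}^n A/\mathfrak p_i^{e_i}$ is a pseudo-isomorphism with $\mathfrak p_i$ (not necessarily distinct) primes of height $1$ and $e_i\ge 1$; such a pseudo-isomorphism exists, and the pairs $(\mathfrak p_i,e_i)$ are unique up to order. Let $B=A[[t]]$ be the ring of power series in one variable over $A$ (again a noetherian Krull domain), and let $P$ be a pseudo-null $B$-module. Write $P_t=\{x\in P: tx=0\}$. Then $P_t$ and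 $P/tP$ are finitely generated torsion $A$-modules, and $$Ch_A(P_t)=Ch_A(P/tP).$$ -/

import Mathlib

open scoped PowerSeries Pointwise

/-- An integral domain `A` is a Krull domain if it is the intersection, inside its fraction field,
of its localizations at the primes of height one, all these localizations are discrete valuation
rings, and every nonzero element of `A` is a unit in all but finitely many of them. -/
class IsKrullDomain (A : Type*) [CommRing A] [IsDomain A] : Prop where
  iInf_localization_eq_bot :
    (⨅ p : {p : PrimeSpectrum A // p.asIdeal.height = 1},
      Localization.subalgebra.ofField (FractionRing A) p.1.asIdeal.primeCompl
        p.1.asIdeal.primeCompl_le_nonZeroDivisors) = (⊥ : Subalgebra A (FractionRing A))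
  isDiscreteValuationRing : ∀ p : PrimeSpectrum A, p.asIdeal.height = 1 →
    IsDiscreteValuationRing (Localization.AtPrime p.asIdeal)
  finite_not_isUnit : ∀ x : A, x ≠ 0 →
    {p : PrimeSpectrum A | p.asIdeal.height = 1 ∧
      ¬ IsUnit (algebraMap A (Localization.AtPrime p.asIdeal) x)}.Finite

/-- A pseudo-null module is a finitely generated torsion module whose annihilator has height at
least 2 (the unit ideal has height `⊤`, so the zero module is pseudo-null). -/
structure IsPseudoNull (A M : Type*) [CommRing A] [AddCommGroup M] [Module A M] : Prop where
  finite : Module.Finite A M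
  isTorsion : Module.IsTorsion A M
  two_le_height : 2 ≤ (Module.annihilator A M).height

/-- A pseudo-isomorphism is a linear map with pseudo-null kernel and cokernel. -/
structure IsPseudoIsomorphism {A M N : Type*} [CommRing A] [AddCommGroup M] [Module A M]
    [AddCommGroup N] [Module A N] (f : M →ₗ[A] N) : Prop where
  ker : IsPseudoNull A (LinearMap.ker f)
  coker : IsPseudoNull A (N ⧸ LinearMap.range f)

/-- There is a pseudo-isomorphism from `M` to an elementary module `⨁ i, A ⧸ (p i) ^ (e i)`, where
the `p i` are (not necessarily distinct) primes of height one, and `I` is the product of the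
`(p i) ^ (e i)`. -/
def IsElementaryProduct (A M : Type*) [CommRing A] [AddCommGroup M] [Module A M]
    (I : Ideal A) : Prop :=
  ∃ (n : ℕ) (p : Fin n → Ideal A) (e : Fin n → ℕ),
    (∀ i, (p i).IsPrime ∧ (p i).height = 1 ∧ 0 < e i) ∧
    (∃ f : M →ₗ[A] ((i : Fin n) → A ⧸ (p i) ^ (e i)), IsPseudoIsomorphism f) ∧
    I = ∏ i, (p i) ^ (e i)

open Classical in
/-- The characteristic ideal of a finitely generated module `M` over a noetherian Krull domain `A`:
it is `0` if `M` is not torsion, and `∏ (p i) ^ (e i)` if `M` is pseudo-isomorphic to the elementary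
module `⨁ i, A ⧸ (p i) ^ (e i)`. (Over a noetherian Krull domain, every finitely generated torsion
module is pseudo-isomorphic to an elementary module, whose pairs `(p i, e i)` are uniquely
determined up to order.) -/
noncomputable def charIdeal (A M : Type*) [CommRing A] [AddCommGroup M] [Module A M] : Ideal A :=
  if h : Module.IsTorsion A M ∧ ∃ I, IsElementaryProduct A M I then h.2.choose else ⊥

/-!
Up to pseudo-isomorphism, a finitely generated torsion `A`-module `M` is determined by the lengths
of its localizations at the primes `p` of height one, and `Ch_A(M)` is the product of the `p` raised
to these lengths. So it suffices to show that the Euler characteristic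
`length P[X]_p - length (P/XP)_p` vanishes. By the snake lemma it is additive in short exact
sequences, and dévissage reduces the claim to `P = A⟦X⟧/q` with `q` prime of height at least two.
If `X ∈ q`, then multiplication by `X` is zero and both terms are `P`. If `X ∉ q`, then `P[X] = 0`,
and `(P/XP)_p = 0` because `(p, X)`, a prime of height at most two containing `X`, cannot
contain `q`.
-/

section LocalLength

variable {A : Type*} [CommRing A] (p : PrimeSpectrum A)

/-- The length of `M_p` over `A_p`; the multiplicity of `p` in the characteristic ideal of `M`. -/
noncomputable def localLength (M : Type*) [AddCommGroup M] [Module A M] : ℕ∞ :=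
  Module.length (Localization.AtPrime p.asIdeal) (LocalizedModule p.asIdeal.primeCompl M)

variable {M N Q : Type*} [AddCommGroup M] [Module A M] [AddCommGroup N] [Module A N]
  [AddCommGroup Q] [Module A Q]

theorem localLength_eq_length_of_isLocalizedModule {M' : Type*} [AddCommGroup M'] [Module A M']
    [Module (Localization.AtPrime p.asIdeal) M']
    [IsScalarTower A (Localization.AtPrime p.asIdeal) M']
    (f : M →ₗ[A] M') [IsLocalizedModule p.asIdeal.primeCompl f] :
    localLength p M = Module.length (Localization.AtPrime p.asIdeal) M' :=
  ((IsLocalizedModule.linearEquiv p.asIdeal.primeCompl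
    (LocalizedModule.mkLinearMap p.asIdeal.primeCompl M) f).extendScalarsOfIsLocalization
      p.asIdeal.primeCompl (Localization.AtPrime p.asIdeal)).length_eq

theorem localLength_eq_zero_iff : localLength p M = 0 ↔ p ∉ Module.support A M :=
  Module.length_eq_zero_iff.trans Module.notMem_support_iff.symm

variable {p} in
theorem localLength_eq_zero_of_mem_annihilator {s : A} (hs : s ∈ Module.annihilator A M)
    (hsp : s ∉ p.asIdeal) : localLength p M = 0 :=
  (localLength_eq_zero_iff p).mpr fun h ↦ hsp (Module.annihilator_le_of_mem_support h hs)

theorem localLength_eq_zero_of_subsingleton [Subsingleton M] : localLength p M = 0 :=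
  (localLength_eq_zero_iff p).mpr (by simp [Module.support_eq_empty])

theorem localLength_eq_add_of_exact {f : M →ₗ[A] N} {g : N →ₗ[A] Q} (hf : Function.Injective f)
    (hg : Function.Surjective g) (h : Function.Exact f g) :
    localLength p N = localLength p M + localLength p Q :=
  Module.length_eq_add_of_exact (LocalizedModule.map p.asIdeal.primeCompl f)
    (LocalizedModule.map p.asIdeal.primeCompl g) (LocalizedModule.map_injective _ f hf)
    (LocalizedModule.map_surjective _ g hg) (LocalizedModule.map_exact _ f g h)

theorem localLength_congr (e : M ≃ₗ[A] N) : localLength p M = localLength p N :=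
  localLength_eq_length_of_isLocalizedModule p
    (LocalizedModule.mkLinearMap p.asIdeal.primeCompl N ∘ₗ e.toLinearMap)

theorem localLength_eq_ker_add_range (f : M →ₗ[A] N) :
    localLength p M = localLength p (LinearMap.ker f) + localLength p (LinearMap.range f) :=
  localLength_eq_add_of_exact p (Submodule.subtype_injective (LinearMap.ker f))
    f.surjective_rangeRestrict
    (LinearMap.exact_iff.mpr (by rw [Submodule.range_subtype, LinearMap.ker_rangeRestrict]))

theorem localLength_eq_range_add_coker (f : M →ₗ[A] N) :
    localLength p N = localLength p (LinearMap.range f) + localLength p (N ⧸ LinearMap.range f) :=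
  localLength_eq_add_of_exact p (Submodule.subtype_injective (LinearMap.range f))
    (Submodule.mkQ_surjective _)
    (LinearMap.exact_iff.mpr (by rw [Submodule.range_subtype, Submodule.ker_mkQ]))

theorem localLength_add_add_eq_of_exact₆ {X₁ X₂ X₃ X₄ X₅ X₆ : Type*}
    [AddCommGroup X₁] [Module A X₁] [AddCommGroup X₂] [Module A X₂] [AddCommGroup X₃] [Module A X₃]
    [AddCommGroup X₄] [Module A X₄] [AddCommGroup X₅] [Module A X₅] [AddCommGroup X₆] [Module A X₆]
    {f₁ : X₁ →ₗ[A] X₂} {f₂ : X₂ →ₗ[A] X₃} {f₃ : X₃ →ₗ[A] X₄} {f₄ : X₄ →ₗ[A] X₅} {f₅ : X₅ →ₗ[A] X₆}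
    (h₁ : Function.Injective f₁) (h₁₂ : Function.Exact f₁ f₂) (h₂₃ : Function.Exact f₂ f₃)
    (h₃₄ : Function.Exact f₃ f₄) (h₄₅ : Function.Exact f₄ f₅) (h₅ : Function.Surjective f₅) :
    localLength p X₁ + localLength p X₃ + localLength p X₅ =
      localLength p X₂ + localLength p X₄ + localLength p X₆ := by
  rw [localLength_eq_ker_add_range p f₂, localLength_eq_ker_add_range p f₃,
    localLength_eq_ker_add_range p f₄, localLength_eq_ker_add_range p f₅,
    h₁₂.linearMap_ker_eq, h₂₃.linearMap_ker_eq, h₃₄.linearMap_ker_eq, h₄₅.linearMap_ker_eq,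
    LinearMap.range_eq_top.mpr h₅, ← localLength_congr p (LinearEquiv.ofInjective f₁ h₁),
    localLength_congr p (Submodule.topEquiv (R := A) (M := X₆))]
  ring

theorem localLength_pi {ι : Type*} [Fintype ι] (N : ι → Type*) [∀ i, AddCommGroup (N i)]
    [∀ i, Module A (N i)] : localLength p (∀ i, N i) = ∑ i, localLength p (N i) := by
  rw [localLength_eq_length_of_isLocalizedModule p
    (.pi fun i ↦ LocalizedModule.mkLinearMap p.asIdeal.primeCompl (N i) ∘ₗ .proj i),
    Module.length_pi_of_fintype]
  rfl

theorem localLength_quotient_eq_length (I : Ideal A) :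
    localLength p (A ⧸ I) = Module.length (Localization.AtPrime p.asIdeal)
      (Localization.AtPrime p.asIdeal ⧸ I.map (algebraMap A (Localization.AtPrime p.asIdeal))) := by
  let f := Submodule.toLocalizedQuotient' (Localization.AtPrime p.asIdeal) p.asIdeal.primeCompl
    (Algebra.linearMap A (Localization.AtPrime p.asIdeal)) I
  rw [localLength_eq_length_of_isLocalizedModule p f, Ideal.localized'_eq_map]

theorem localLength_quotient_self : localLength p (A ⧸ p.asIdeal) = 1 := by
  rw [localLength_quotient_eq_length, Localization.AtPrime.map_eq_maximalIdeal,
    Module.length_eq_one_iff]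
  exact isSimpleModule_iff_isCoatom.mpr (IsLocalRing.maximalIdeal.isMaximal _).out

theorem localLength_quotient_pow_self [IsDomain A]
    [IsDiscreteValuationRing (Localization.AtPrime p.asIdeal)] (e : ℕ) :
    localLength p (A ⧸ p.asIdeal ^ e) = e := by
  obtain ⟨ϖ, hϖ⟩ := IsDiscreteValuationRing.exists_irreducible (Localization.AtPrime p.asIdeal)
  rw [localLength_quotient_eq_length, Ideal.map_pow, Localization.AtPrime.map_eq_maximalIdeal,
    hϖ.maximalIdeal_eq, Ideal.span_singleton_pow]
  change Ring.ord _ _ = _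
  rw [Ring.ord_pow (mem_nonZeroDivisors_of_ne_zero hϖ.ne_zero), Ring.ord_of_irreducible hϖ,
    nsmul_one]

variable {p} in
theorem localLength_quotient_eq_zero {I : Ideal A} (h : ¬ I ≤ p.asIdeal) :
    localLength p (A ⧸ I) = 0 := by
  obtain ⟨s, hs, hsp⟩ := SetLike.not_le_iff_exists.mp h
  exact localLength_eq_zero_of_mem_annihilator (by rwa [Ideal.annihilator_quotient]) hsp

variable {p} in
theorem localLength_ne_top [IsNoetherianRing A] [hM : Module.Finite A M]
    (h : ∀ q < p, q ∉ Module.support A M) : localLength p M ≠ ⊤ := by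
  induction hM using IsNoetherianRing.induction_on_isQuotientEquivQuotientPrime A with
  | subsingleton M =>
    rw [localLength_eq_zero_of_subsingleton]
    exact ENat.zero_ne_top
  | quotient M q e =>
    have hq : localLength q M = 1 := by rw [localLength_congr q e, localLength_quotient_self]
    obtain rfl | hqp := eq_or_ne q p
    · rw [hq]
      exact ENat.one_ne_top
    · have hqp' : ¬ q.asIdeal ≤ p.asIdeal := fun hle ↦ one_ne_zero
        (hq.symm.trans ((localLength_eq_zero_iff q).mpr (h q (lt_of_le_of_ne hle hqp))))
      rw [localLength_congr p e, localLength_quotient_eq_zero hqp']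
      exact ENat.zero_ne_top
  | exact M₁ M M₂ f g hf hg hfg ih₁ ih₂ =>
    rw [Module.support_of_exact hfg hf hg] at h
    rw [localLength_eq_add_of_exact p hf hg hfg]
    exact WithTop.add_ne_top.mpr
      ⟨ih₁ fun q hq hq₁ ↦ h q hq (.inl hq₁), ih₂ fun q hq hq₂ ↦ h q hq (.inr hq₂)⟩

end LocalLength

section PseudoNull

variable {A : Type*} [CommRing A] {M N : Type*} [AddCommGroup M] [Module A M] [AddCommGroup N]
  [Module A N]

theorem IsPseudoNull.localLength_eq_zero (h : IsPseudoNull A M) {p : PrimeSpectrum A}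
    (hp : p.asIdeal.height ≤ 1) : localLength p M = 0 := by
  rw [localLength_eq_zero_iff]
  intro hpM
  have h2 : (2 : ℕ∞) ≤ 1 := h.two_le_height.trans
    ((Ideal.height_mono (Module.annihilator_le_of_mem_support hpM)).trans hp)
  exact absurd h2 (by norm_num)

theorem IsPseudoIsomorphism.localLength_eq {f : M →ₗ[A] N} (h : IsPseudoIsomorphism f)
    {p : PrimeSpectrum A} (hp : p.asIdeal.height ≤ 1) : localLength p M = localLength p N := by
  rw [localLength_eq_ker_add_range p f, localLength_eq_range_add_coker p f,
    h.ker.localLength_eq_zero hp, h.coker.localLength_eq_zero hp, zero_add, add_zero]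

theorem isTorsion_of_bot_notMem_support [IsDomain A] (h : ⊥ ∉ Module.support A M) :
    Module.IsTorsion A M := fun {m} ↦ by
  obtain ⟨a, ha, ham⟩ := Module.notMem_support_iff'.mp h m
  exact ⟨⟨a, mem_nonZeroDivisors_of_ne_zero ha⟩, ham⟩

theorem bot_notMem_support [IsDomain A] (h : Module.IsTorsion A M) : ⊥ ∉ Module.support A M :=
  Module.notMem_support_iff'.mpr fun m ↦
    let ⟨a, ha⟩ := @h m
    ⟨a, nonZeroDivisors.ne_zero a.2, ha⟩

theorem isPseudoNull_iff_localLength_eq_zero [IsDomain A] [hM : Module.Finite A M] :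
    IsPseudoNull A M ↔ ∀ p : PrimeSpectrum A, p.asIdeal.height ≤ 1 → localLength p M = 0 := by
  refine ⟨fun h p hp ↦ h.localLength_eq_zero hp, fun h ↦ ⟨hM, ?_, ?_⟩⟩
  · exact isTorsion_of_bot_notMem_support ((localLength_eq_zero_iff _).mp (h ⊥ (by simp)))
  · rw [Ideal.height_eq_inf_minimalPrimes]
    refine le_iInf₂ fun q hq ↦ ?_
    by_contra! hlt
    have hq1 : q.height ≤ 1 := Order.le_of_lt_add_one (by rwa [one_add_one_eq_two])
    exact (localLength_eq_zero_iff ⟨q, hq.isPrime⟩).mp (h _ hq1)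
      (Module.mem_support_iff_of_finite.mpr hq.1.2)

theorem height_eq_one_of_mem_support [IsDomain A] (hM : Module.IsTorsion A M) {p : PrimeSpectrum A}
    (hp : p.asIdeal.height ≤ 1) (hpM : p ∈ Module.support A M) : p.asIdeal.height = 1 := by
  refine le_antisymm hp (Order.one_le_iff_ne_zero.mpr fun h0 ↦ bot_notMem_support hM ?_)
  rwa [← show p = ⊥ from PrimeSpectrum.ext (Ideal.height_eq_zero_iff_eq_bot.mp h0)]

variable [IsDomain A] [IsNoetherianRing A]

theorem notMem_support_of_lt (hM : Module.IsTorsion A M) {p q : PrimeSpectrum A}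
    (hp : p.asIdeal.height ≤ 1) (hqp : q < p) : q ∉ Module.support A M := by
  have hq : q.asIdeal.height = 0 := Order.lt_one_iff.mp
    ((Ideal.height_strict_mono_of_isPrime hqp).trans_le hp)
  obtain rfl : q = ⊥ := PrimeSpectrum.ext (Ideal.height_eq_zero_iff_eq_bot.mp hq)
  exact bot_notMem_support hM

theorem localLength_ne_top_of_isTorsion [Module.Finite A M] (hM : Module.IsTorsion A M)
    {p : PrimeSpectrum A} (hp : p.asIdeal.height ≤ 1) : localLength p M ≠ ⊤ :=
  localLength_ne_top fun _ ↦ notMem_support_of_lt hM hp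

theorem isPseudoIsomorphism_of_localLength_eq [Module.Finite A M] [Module.Finite A N]
    (hM : Module.IsTorsion A M) {f : M →ₗ[A] N}
    (hker : ∀ p : PrimeSpectrum A, p.asIdeal.height ≤ 1 → localLength p (LinearMap.ker f) = 0)
    (h : ∀ p : PrimeSpectrum A, p.asIdeal.height ≤ 1 → localLength p M = localLength p N) :
    IsPseudoIsomorphism f := by
  refine ⟨isPseudoNull_iff_localLength_eq_zero.mpr hker,
    isPseudoNull_iff_localLength_eq_zero.mpr fun p hp ↦ ?_⟩
  have hrange : localLength p M = localLength p (LinearMap.range f) := by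
    rw [localLength_eq_ker_add_range p f, hker p hp, zero_add]
  have hfinite := localLength_ne_top_of_isTorsion hM hp
  have hsum := localLength_eq_range_add_coker p f
  rw [← h p hp, ← hrange] at hsum
  exact (WithTop.add_left_cancel hfinite (hsum.symm.trans (add_zero _).symm))

end PseudoNull

section Elementary

/-- A domain is regular in codimension one if its local rings at the primes of height one are
discrete valuation rings. This is Serre's condition (R₁), and the part of the definition of a Krull
domain which governs modules up to pseudo-isomorphism. -/
class IsRegularInCodimOne (A : Type*) [CommRing A] [IsDomain A] : Prop where
  isDiscreteValuationRing : ∀ p : PrimeSpectrum A, p.asIdeal.height = 1 →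
    IsDiscreteValuationRing (Localization.AtPrime p.asIdeal)

instance IsKrullDomain.isRegularInCodimOne {A : Type*} [CommRing A] [IsDomain A]
    [IsKrullDomain A] : IsRegularInCodimOne A :=
  ⟨IsKrullDomain.isDiscreteValuationRing⟩

variable {A : Type*} [CommRing A] [IsNoetherianRing A]

theorem localLength_quotient_pow_of_ne {p q : PrimeSpectrum A}
    (h : p.asIdeal.height ≤ q.asIdeal.height) (hqp : q ≠ p) (e : ℕ) :
    localLength p (A ⧸ q.asIdeal ^ e) = 0 := by
  refine localLength_quotient_eq_zero fun hle ↦ ?_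
  have hlt : q < p := lt_of_le_of_ne (Ideal.IsPrime.le_of_pow_le hle) hqp
  exact (Ideal.height_strict_mono_of_isPrime hlt).not_ge h

open Classical in
theorem localLength_pi_quotient_pow [IsDomain A] [IsRegularInCodimOne A] {ι : Type*} [Fintype ι]
    {q : ι → PrimeSpectrum A} (hq : ∀ i, (q i).asIdeal.height = 1) (e : ι → ℕ)
    {p : PrimeSpectrum A} (hp : p.asIdeal.height ≤ 1) :
    localLength p (∀ i, A ⧸ (q i).asIdeal ^ e i) = ∑ i, if q i = p then (e i : ℕ∞) else 0 := by
  rw [localLength_pi]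
  refine Finset.sum_congr rfl fun i _ ↦ ?_
  split_ifs with h
  · subst h
    have := IsRegularInCodimOne.isDiscreteValuationRing (q i) (hq i)
    exact localLength_quotient_pow_self (q i) (e i)
  · exact localLength_quotient_pow_of_ne (hp.trans_eq (hq i).symm) h (e i)

end Elementary

section Structure

theorem exists_equiv_pi_quotient_maximalIdeal_pow {R : Type*} [CommRing R] [IsDomain R]
    [IsDiscreteValuationRing R] {M : Type*} [AddCommGroup M] [Module R M] [Module.Finite R M]
    (hM : Module.IsTorsion R M) :
    ∃ (d : ℕ) (k : Fin d → ℕ),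
      Nonempty (M ≃ₗ[R] ∀ i, R ⧸ IsLocalRing.maximalIdeal R ^ k i) := by
  obtain ⟨ϖ, hϖ⟩ := IsDiscreteValuationRing.exists_irreducible R
  have hM' : Module.IsTorsion' M (Submonoid.powers ϖ) := by
    refine (Submodule.isTorsion'_powers_iff ϖ).mpr fun x ↦ ?_
    obtain ⟨a, ha⟩ := @hM x
    obtain ⟨n, u, hu⟩ := IsDiscreteValuationRing.associated_pow_irreducible
      (nonZeroDivisors.ne_zero a.2) hϖ
    exact ⟨n, by rw [← hu, mul_comm, mul_smul, ← Submonoid.smul_def, ha, smul_zero]⟩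
  obtain ⟨d, k, ⟨l⟩⟩ := Module.torsion_by_prime_power_decomposition hϖ hM'
  refine ⟨d, k, ⟨l ≪≫ₗ DirectSum.linearEquivFunOnFintype R (Fin d) _ ≪≫ₗ
    LinearEquiv.piCongrRight fun i ↦ Submodule.quotEquivOfEq _ _ ?_⟩⟩
  rw [hϖ.maximalIdeal_eq, Ideal.span_singleton_pow]

variable {A : Type*} [CommRing A] {M : Type*} [AddCommGroup M] [Module A M]

theorem isTorsion_localizedModule (S : Submonoid A) (hM : Module.IsTorsion A M) :
    Module.IsTorsion (Localization S) (LocalizedModule S M) := fun {x} ↦ by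
  induction x with
  | h m s =>
    obtain ⟨a, ha⟩ := @hM m
    refine ⟨⟨algebraMap A _ a, IsLocalization.map_nonZeroDivisors_le S _ ⟨a, a.2, rfl⟩⟩, ?_⟩
    rw [Submonoid.mk_smul, algebraMap_smul, LocalizedModule.smul'_mk, ← Submonoid.smul_def, ha,
      LocalizedModule.zero_mk]

theorem exists_linearMap_notMem_support_ker [Module.FinitePresentation A M] (p : PrimeSpectrum A)
    {N N' : Type*} [AddCommGroup N] [Module A N] [AddCommGroup N'] [Module A N'] (g : N →ₗ[A] N')
    [IsLocalizedModule p.asIdeal.primeCompl g]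
    {l : LocalizedModule p.asIdeal.primeCompl M →ₗ[A] N'} (hl : Function.Injective l) :
    ∃ f : M →ₗ[A] N, p ∉ Module.support A (LinearMap.ker f) := by
  obtain ⟨f, s, hf⟩ := Module.FinitePresentation.exists_lift_of_isLocalizedModule
    p.asIdeal.primeCompl g (l ∘ₗ LocalizedModule.mkLinearMap p.asIdeal.primeCompl M)
  refine ⟨f, Module.notMem_support_iff'.mpr fun ⟨x, hx⟩ ↦ ?_⟩
  have h0 : l (LocalizedModule.mkLinearMap p.asIdeal.primeCompl M ((s : A) • x)) = 0 := by
    rw [map_smul, map_smul]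
    exact (LinearMap.congr_fun hf x).symm.trans (by simp [LinearMap.mem_ker.mp hx])
  obtain ⟨c, hc⟩ := (IsLocalizedModule.eq_zero_iff p.asIdeal.primeCompl _).mp
    (hl (h0.trans (map_zero l).symm))
  exact ⟨c * s, (c * s).2, Subtype.ext (by rwa [Submodule.coe_smul, mul_smul])⟩

theorem exists_linearMap_pi_quotient_pow [IsDomain A] [IsNoetherianRing A] [Module.Finite A M]
    (hM : Module.IsTorsion A M) (p : PrimeSpectrum A)
    [IsDiscreteValuationRing (Localization.AtPrime p.asIdeal)] :
    ∃ (d : ℕ) (k : Fin d → ℕ) (f : M →ₗ[A] ∀ i, A ⧸ p.asIdeal ^ k i),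
      localLength p (LinearMap.ker f) = 0 ∧
        localLength p M = localLength p (∀ i, A ⧸ p.asIdeal ^ k i) := by
  obtain ⟨d, k, ⟨l⟩⟩ := exists_equiv_pi_quotient_maximalIdeal_pow
    (isTorsion_localizedModule p.asIdeal.primeCompl hM)
  let g : (∀ i, A ⧸ p.asIdeal ^ k i) →ₗ[A] ∀ i, Localization.AtPrime p.asIdeal ⧸
      Submodule.localized' (Localization.AtPrime p.asIdeal) p.asIdeal.primeCompl
        (Algebra.linearMap A (Localization.AtPrime p.asIdeal)) (p.asIdeal ^ k i) :=
    .pi fun i ↦ Submodule.toLocalizedQuotient' (Localization.AtPrime p.asIdeal)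
      p.asIdeal.primeCompl (Algebra.linearMap A (Localization.AtPrime p.asIdeal))
      (p.asIdeal ^ k i) ∘ₗ .proj i
  have : IsLocalizedModule p.asIdeal.primeCompl g := IsLocalizedModule.pi _ _
  have hpow (i : Fin d) : IsLocalRing.maximalIdeal (Localization.AtPrime p.asIdeal) ^ k i =
      Submodule.localized' (Localization.AtPrime p.asIdeal) p.asIdeal.primeCompl
        (Algebra.linearMap A (Localization.AtPrime p.asIdeal)) (p.asIdeal ^ k i) := by
    rw [Ideal.localized'_eq_map, Ideal.map_pow, Localization.AtPrime.map_eq_maximalIdeal]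
  let l' := l ≪≫ₗ LinearEquiv.piCongrRight fun i ↦ Submodule.quotEquivOfEq _ _ (hpow i)
  have := Module.finitePresentation_of_finite A M
  obtain ⟨f, hf⟩ := exists_linearMap_notMem_support_ker p g (l'.restrictScalars A).injective
  exact ⟨d, k, f, (localLength_eq_zero_iff p).mpr hf,
    l'.length_eq.trans (localLength_eq_length_of_isLocalizedModule p g).symm⟩

end Structure

section Existence

theorem exists_linearEquiv_pi_fin_nontrivial (R : Type*) [Semiring R] {ι : Type*} [Finite ι]
    (N : ι → Type*) [∀ i, AddCommMonoid (N i)] [∀ i, Module R (N i)] :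
    ∃ (n : ℕ) (σ : Fin n → ι), (∀ j, Nontrivial (N (σ j))) ∧
      Nonempty ((∀ i, N i) ≃ₗ[R] ∀ j, N (σ j)) := by
  classical
  let s := {i // Nontrivial (N i)}
  let f : (∀ i, N i) →ₗ[R] ∀ i : s, N i := .pi fun i ↦ .proj i.1
  have hf : Function.Bijective f := by
    refine ⟨fun x y hxy ↦ funext fun i ↦ ?_, fun y ↦ ?_⟩
    · obtain hi | hi := subsingleton_or_nontrivial (N i)
      · exact Subsingleton.elim _ _
      · exact congrFun hxy ⟨i, hi⟩
    · exact ⟨fun i ↦ if hi : Nontrivial (N i) then y ⟨i, hi⟩ else 0, funext fun i ↦ dif_pos i.2⟩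
  let σ := (Finite.equivFin s).symm
  exact ⟨_, fun j ↦ (σ j).1, fun j ↦ (σ j).2, ⟨LinearEquiv.ofBijective f hf ≪≫ₗ
    (LinearEquiv.piCongrLeft R (fun i : s ↦ N i) σ).symm⟩⟩

universe u

variable {A : Type u} [CommRing A] [IsDomain A] [IsNoetherianRing A] {M : Type*} [AddCommGroup M]
  [Module A M] [Module.Finite A M]

theorem finite_setOf_height_le_one_mem_support (hM : Module.IsTorsion A M) :
    {p : PrimeSpectrum A | p.asIdeal.height ≤ 1 ∧ p ∈ Module.support A M}.Finite := by
  refine .subset (.preimage (fun _ _ _ _ ↦ PrimeSpectrum.ext)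
    (Ideal.finite_minimalPrimes_of_isNoetherianRing A (Module.annihilator A M))) ?_
  rintro p ⟨hp, hpM⟩
  refine ⟨⟨p.2, Module.annihilator_le_of_mem_support hpM⟩, fun q ⟨hq, hqM⟩ hqp ↦ ?_⟩
  by_contra hpq
  exact notMem_support_of_lt (q := ⟨q, hq⟩) hM hp (lt_of_le_not_ge hqp hpq)
    (Module.mem_support_iff_of_finite.mpr hqM)

theorem isPseudoIsomorphism_pi_sigma (hM : Module.IsTorsion A M) {T : Type*} [Finite T]
    {q : T → PrimeSpectrum A} (hq : ∀ t, (q t).asIdeal.height = 1) (hqinj : Function.Injective q)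
    (hqM : ∀ p : PrimeSpectrum A, p.asIdeal.height ≤ 1 → (p ∈ Module.support A M ↔ ∃ t, q t = p))
    {d : T → ℕ} {k : ∀ t, Fin (d t) → ℕ} {f : ∀ t, M →ₗ[A] ∀ j, A ⧸ (q t).asIdeal ^ k t j}
    (hker : ∀ t, localLength (q t) (LinearMap.ker (f t)) = 0)
    (hlen : ∀ t, localLength (q t) M = localLength (q t) (∀ j, A ⧸ (q t).asIdeal ^ k t j)) :
    IsPseudoIsomorphism (.pi fun i ↦ .proj i.2 ∘ₗ f i.1 :
      M →ₗ[A] ∀ i : Σ t, Fin (d t), A ⧸ (q i.1).asIdeal ^ k i.1 i.2) := by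
  have := Fintype.ofFinite T
  refine isPseudoIsomorphism_of_localLength_eq hM (fun p hp ↦ ?_) fun p hp ↦ ?_
  · rw [localLength_eq_zero_iff]
    intro h
    obtain ⟨t, rfl⟩ := (hqM p hp).mp
      (Module.support_subset_of_injective _ (Submodule.subtype_injective _) h)
    refine (localLength_eq_zero_iff _).mp (hker t)
      (Module.support_subset_of_injective (Submodule.inclusion fun x hx ↦ ?_)
        (Submodule.inclusion_injective _) h)
    exact funext fun j ↦ congrFun hx ⟨t, j⟩
  · have hne (t : T) (h : q t ≠ p) : ∑ j, localLength p (A ⧸ (q t).asIdeal ^ k t j) = 0 :=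
      Finset.sum_eq_zero fun j _ ↦ localLength_quotient_pow_of_ne (hp.trans_eq (hq t).symm) h _
    rw [localLength_pi, Fintype.sum_sigma]
    by_cases hpM : p ∈ Module.support A M
    · obtain ⟨t, rfl⟩ := (hqM p hp).mp hpM
      rw [Fintype.sum_eq_single t fun t' h ↦ hne t' (hqinj.ne h), ← localLength_pi]
      exact hlen t
    · rw [(localLength_eq_zero_iff p).mpr hpM]
      exact (Finset.sum_eq_zero fun t _ ↦ hne t fun h ↦ hpM ((hqM p hp).mpr ⟨t, h⟩)).symm

theorem exists_isPseudoIsomorphism_pi [IsRegularInCodimOne A] (hM : Module.IsTorsion A M) :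
    ∃ (ι : Type u) (_ : Finite ι) (q : ι → PrimeSpectrum A) (e : ι → ℕ)
      (f : M →ₗ[A] ∀ i, A ⧸ (q i).asIdeal ^ e i),
      (∀ i, (q i).asIdeal.height = 1) ∧ IsPseudoIsomorphism f := by
  let T := {p : PrimeSpectrum A // p.asIdeal.height ≤ 1 ∧ p ∈ Module.support A M}
  have : Finite T := (finite_setOf_height_le_one_mem_support hM).to_subtype
  have hT (p : T) : p.1.asIdeal.height = 1 := height_eq_one_of_mem_support hM p.2.1 p.2.2
  have hlocal (p : T) := by
    have := IsRegularInCodimOne.isDiscreteValuationRing p.1 (hT p)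
    exact exists_linearMap_pi_quotient_pow hM p.1
  choose d k f hker hlen using hlocal
  have hTM (p : PrimeSpectrum A) (hp : p.asIdeal.height ≤ 1) :
      p ∈ Module.support A M ↔ ∃ t : T, t.1 = p :=
    ⟨fun h ↦ ⟨⟨p, hp, h⟩, rfl⟩, fun ⟨t, ht⟩ ↦ ht ▸ t.2.2⟩
  exact ⟨Σ t : T, Fin (d t), inferInstance, fun i ↦ i.1.1, fun i ↦ k i.1 i.2, _, fun i ↦ hT i.1,
    isPseudoIsomorphism_pi_sigma hM hT Subtype.val_injective hTM hker hlen⟩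

theorem exists_isElementaryProduct [IsRegularInCodimOne A] (hM : Module.IsTorsion A M) :
    ∃ I, IsElementaryProduct A M I := by
  obtain ⟨ι, _, q, e, f, hq, hf⟩ := exists_isPseudoIsomorphism_pi hM
  obtain ⟨n, σ, hσ, ⟨E⟩⟩ :=
    exists_linearEquiv_pi_fin_nontrivial A fun i ↦ A ⧸ (q i).asIdeal ^ e i
  have he (j : Fin n) : 0 < e (σ j) := Nat.pos_of_ne_zero fun h ↦
    Ideal.Quotient.nontrivial_iff.mp (hσ j) (by rw [h, pow_zero, Ideal.one_eq_top])
  refine ⟨_, n, fun j ↦ (q (σ j)).asIdeal, fun j ↦ e (σ j), fun j ↦ ⟨(q (σ j)).2, hq (σ j), he j⟩,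
    ⟨E.toLinearMap ∘ₗ f, isPseudoIsomorphism_of_localLength_eq hM (fun p hp ↦ ?_) fun p hp ↦ ?_⟩,
    rfl⟩
  · rw [LinearEquiv.ker_comp]
    exact hf.ker.localLength_eq_zero hp
  · exact (hf.localLength_eq hp).trans (localLength_congr p E)

end Existence

section CharIdeal

variable {A : Type*} [CommRing A] [IsDomain A] [IsNoetherianRing A] [IsRegularInCodimOne A]
  {M : Type*} [AddCommGroup M] [Module A M]

theorem IsElementaryProduct.eq_finprod {I : Ideal A} (h : IsElementaryProduct A M I) :
    I = ∏ᶠ p : {p : PrimeSpectrum A // p.asIdeal.height = 1},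
      p.1.asIdeal ^ (localLength p.1 M).toNat := by
  classical
  obtain ⟨n, q, e, hq, ⟨f, hf⟩, rfl⟩ := h
  let q' (i : Fin n) : {p : PrimeSpectrum A // p.asIdeal.height = 1} :=
    ⟨⟨q i, (hq i).1⟩, (hq i).2.1⟩
  have hpow (p : {p : PrimeSpectrum A // p.asIdeal.height = 1}) :
      p.1.asIdeal ^ (localLength p.1 M).toNat =
        ∏ i, if p = q' i then p.1.asIdeal ^ e i else 1 := by
    have hlength : localLength p.1 M = (∑ i, if p = q' i then e i else 0 : ℕ) := by
      rw [hf.localLength_eq p.2.le]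
      refine (localLength_pi_quotient_pow (fun i ↦ (q' i).2) e p.2.le).trans ?_
      push_cast
      simp only [← Subtype.ext_iff, eq_comm]
    rw [hlength, ENat.toNat_natCast, ← Finset.prod_pow_eq_pow_sum]
    simp only [pow_ite, pow_zero]
  have hfinite (i : Fin n) : (Function.mulSupport fun p ↦
      if p = q' i then p.1.asIdeal ^ e i else 1).Finite :=
    (Set.finite_singleton (q' i)).subset fun p hp ↦ by
      by_contra hne
      exact hp (if_neg hne)
  rw [finprod_congr hpow, finprod_prod_comm _ _ fun i _ ↦ hfinite i]
  refine Finset.prod_congr rfl fun i _ ↦ ?_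
  rw [finprod_eq_single _ (q' i) fun p hp ↦ if_neg hp, if_pos rfl]

theorem charIdeal_eq_finprod [Module.Finite A M] (hM : Module.IsTorsion A M) :
    charIdeal A M = ∏ᶠ p : {p : PrimeSpectrum A // p.asIdeal.height = 1},
      p.1.asIdeal ^ (localLength p.1 M).toNat := by
  have h : Module.IsTorsion A M ∧ ∃ I, IsElementaryProduct A M I :=
    ⟨hM, exists_isElementaryProduct hM⟩
  rw [charIdeal, dif_pos h]
  exact h.2.choose_spec.eq_finprod

end CharIdeal

section PowerSeries

open PowerSeries

variable {A : Type*} [CommRing A]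

theorem span_X_eq_ker_constantCoeff :
    Ideal.span {(X : A⟦X⟧)} = RingHom.ker (constantCoeff (R := A)) :=
  Ideal.ext fun _ ↦ Ideal.mem_span_singleton.trans X_dvd_iff

theorem height_comap_constantCoeff_le [IsNoetherianRing A] (p : Ideal A) [p.IsPrime] :
    (p.comap (constantCoeff (R := A))).height ≤ p.height + 1 := by
  let e : (A⟦X⟧ ⧸ Ideal.span {(X : A⟦X⟧)}) ≃+* A :=
    (Ideal.quotEquivOfEq span_X_eq_ker_constantCoeff).trans
      (RingHom.quotientKerEquivOfSurjective constantCoeff_surj)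
  have hmap : (p.comap (constantCoeff (R := A))).map (Ideal.Quotient.mk (Ideal.span {X})) =
      p.comap e := by
    rw [← Ideal.map_comap_of_surjective _ Ideal.Quotient.mk_surjective (p.comap e)]
    rfl
  rw [← RingEquiv.height_comap e, ← hmap]
  exact Ideal.height_le_height_add_one_of_mem (by simp)

variable {p : PrimeSpectrum A} {N : Type*} [AddCommGroup N] [Module A⟦X⟧ N] [Module A N]
  [IsScalarTower A A⟦X⟧ N]

theorem constantCoeff_smul_of_X_smul_eq_zero (f : A⟦X⟧) {n : N} (hn : (X : A⟦X⟧) • n = 0) :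
    constantCoeff f • n = f • n := by
  conv_rhs => rw [eq_shift_mul_X_add_const f]
  rw [add_smul, mul_smul, hn, smul_zero, zero_add]
  exact (algebraMap_smul A⟦X⟧ (constantCoeff f) n).symm

theorem finite_of_X_mem_annihilator [Module.Finite A⟦X⟧ N]
    (hX : X ∈ Module.annihilator A⟦X⟧ N) : Module.Finite A N := by
  obtain ⟨s, hs⟩ := Module.Finite.fg_top (R := A⟦X⟧) (M := N)
  refine ⟨s, eq_top_iff.mpr fun n _ ↦ ?_⟩
  have hn : n ∈ Submodule.span A⟦X⟧ (s : Set N) := hs ▸ Submodule.mem_top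
  induction hn using Submodule.span_induction with
  | mem x hx => exact Submodule.subset_span hx
  | zero => exact zero_mem _
  | add x y _ _ hx hy => exact add_mem (hx trivial) (hy trivial)
  | smul f x _ hx =>
    rw [← constantCoeff_smul_of_X_smul_eq_zero f (Module.mem_annihilator.mp hX x)]
    exact Submodule.smul_mem _ _ (hx trivial)

theorem notMem_support_of_X_mem_annihilator (hX : X ∈ Module.annihilator A⟦X⟧ N)
    (h : ¬ Module.annihilator A⟦X⟧ N ≤ p.asIdeal.comap constantCoeff) :
    p ∉ Module.support A N := by
  obtain ⟨f, hf, hfp⟩ := SetLike.not_le_iff_exists.mp h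
  refine Module.notMem_support_iff'.mpr fun n ↦ ⟨constantCoeff f, hfp, ?_⟩
  rw [constantCoeff_smul_of_X_smul_eq_zero f (Module.mem_annihilator.mp hX n)]
  exact Module.mem_annihilator.mp hf n

end PowerSeries

section Snake

variable {R : Type*} [CommRing R] (t : R) {N₁ N₂ N₃ : Type*} [AddCommGroup N₁] [Module R N₁]
  [AddCommGroup N₂] [Module R N₂] [AddCommGroup N₃] [Module R N₃]

/-- The map induced by a linear map on the submodules of elements killed by `t`, the counterpart of
`QuotSMulTop.map` for the kernel of multiplication by `t`. -/
def torsionByMap (f : N₁ →ₗ[R] N₂) : Submodule.torsionBy R N₁ t →ₗ[R] Submodule.torsionBy R N₂ t :=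
  f.restrict fun x hx ↦ by
    rw [Submodule.mem_torsionBy_iff] at hx ⊢
    rw [← map_smul, hx, map_zero]

theorem exact_torsionBy_subtype_lsmul (N : Type*) [AddCommGroup N] [Module R N] :
    Function.Exact (Submodule.torsionBy R N t).subtype (LinearMap.lsmul R N t) :=
  LinearMap.exact_subtype_ker_map _

theorem exact_lsmul_mkQ (N : Type*) [AddCommGroup N] [Module R N] :
    Function.Exact (LinearMap.lsmul R N t) (t • (⊤ : Submodule R N)).mkQ := by
  rw [LinearMap.exact_iff, Submodule.ker_mkQ, LinearMap.range_eq_map]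
  rfl

variable {t} {f : N₁ →ₗ[R] N₂} {g : N₂ →ₗ[R] N₃}

theorem torsionByMap_injective (hf : Function.Injective f) :
    Function.Injective (torsionByMap t f) :=
  fun _ _ h ↦ Subtype.ext (hf (congrArg Subtype.val h))

theorem torsionByMap_exact (hf : Function.Injective f) (h : Function.Exact f g) :
    Function.Exact (torsionByMap t f) (torsionByMap t g) := by
  rintro ⟨y, hy⟩
  constructor
  · intro hgy
    obtain ⟨x, rfl⟩ := (h y).mp (congrArg Subtype.val hgy)
    refine ⟨⟨x, ?_⟩, rfl⟩
    rw [Submodule.mem_torsionBy_iff] at hy ⊢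
    exact hf (by rw [map_smul, hy, map_zero])
  · rintro ⟨x, hx⟩
    rw [← hx]
    exact Subtype.ext (h.apply_apply_eq_zero x.1)

theorem exists_connecting_torsionBy_quotSMulTop (hf : Function.Injective f)
    (hg : Function.Surjective g) (h : Function.Exact f g) :
    ∃ δ : Submodule.torsionBy R N₃ t →ₗ[R] QuotSMulTop t N₁,
      Function.Exact (torsionByMap t g) δ ∧ Function.Exact δ (QuotSMulTop.map t f) := by
  have hft : f ∘ₗ LinearMap.lsmul R N₁ t = LinearMap.lsmul R N₂ t ∘ₗ f :=
    LinearMap.ext fun x ↦ map_smul f t x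
  have hgt : g ∘ₗ LinearMap.lsmul R N₂ t = LinearMap.lsmul R N₃ t ∘ₗ g :=
    LinearMap.ext fun x ↦ map_smul g t x
  have hker₂ := exact_torsionBy_subtype_lsmul t N₂
  have hker₃ := exact_torsionBy_subtype_lsmul t N₃
  have hcoker₁ := exact_lsmul_mkQ t N₁
  have hcoker₂ := exact_lsmul_mkQ t N₂
  exact ⟨SnakeLemma.δ' _ _ _ f g h f g h hft hgt _ hker₃ _ hcoker₁ hg hf,
    SnakeLemma.exact_δ'_right _ _ _ f g h f g h hft hgt _ hker₂ _ hker₃ _ hcoker₁ hg hf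
      _ rfl (Submodule.subtype_injective _),
    SnakeLemma.exact_δ'_left _ _ _ f g h f g h hft hgt _ hker₃ _ hcoker₁ _ hcoker₂ hg hf
      _ rfl (Submodule.mkQ_surjective _)⟩

theorem localLength_torsionBy_add_quotSMulTop {A : Type*} [CommRing A] [Algebra A R]
    [Module A N₁] [IsScalarTower A R N₁] [Module A N₂] [IsScalarTower A R N₂]
    [Module A N₃] [IsScalarTower A R N₃] (p : PrimeSpectrum A) (t : R)
    (hf : Function.Injective f) (hg : Function.Surjective g) (h : Function.Exact f g) :
    localLength p (Submodule.torsionBy R N₁ t) + localLength p (Submodule.torsionBy R N₃ t) +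
        localLength p (QuotSMulTop t N₂) =
      localLength p (Submodule.torsionBy R N₂ t) + localLength p (QuotSMulTop t N₁) +
        localLength p (QuotSMulTop t N₃) := by
  obtain ⟨δ, hgδ, hδf⟩ := exists_connecting_torsionBy_quotSMulTop (t := t) hf hg h
  exact localLength_add_add_eq_of_exact₆ p
    (f₁ := (torsionByMap t f).restrictScalars A) (f₂ := (torsionByMap t g).restrictScalars A)
    (f₃ := δ.restrictScalars A) (f₄ := (QuotSMulTop.map t f).restrictScalars A)
    (f₅ := (QuotSMulTop.map t g).restrictScalars A)
    (torsionByMap_injective hf) (torsionByMap_exact hf h) hgδ hδf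
    (QuotSMulTop.map_exact t h hg) (QuotSMulTop.map_surjective t hg)

end Snake

section EulerCharacteristic

open PowerSeries

theorem mem_annihilator_torsionBy {R N : Type*} [CommRing R] [AddCommGroup N] [Module R N] (t : R) :
    t ∈ Module.annihilator R (Submodule.torsionBy R N t) :=
  (Module.isTorsionBy_iff_mem_annihilator _ _).mp (Submodule.torsionBy_isTorsionBy t)

variable {A : Type*} [CommRing A] {N : Type*} [AddCommGroup N] [Module A⟦X⟧ N]
  [Module A N] [IsScalarTower A A⟦X⟧ N] {p : PrimeSpectrum A}

theorem finite_torsionBy_X [IsNoetherianRing A] [Module.Finite A⟦X⟧ N] :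
    Module.Finite A (Submodule.torsionBy A⟦X⟧ N X) :=
  finite_of_X_mem_annihilator (mem_annihilator_torsionBy X)

theorem finite_quotSMulTop_X [Module.Finite A⟦X⟧ N] :
    Module.Finite A (QuotSMulTop (X : A⟦X⟧) N) :=
  finite_of_X_mem_annihilator (QuotSMulTop.mem_annihilator N X)

theorem notMem_support_torsionBy_X
    (h : ¬ Module.annihilator A⟦X⟧ N ≤ p.asIdeal.comap constantCoeff) :
    p ∉ Module.support A (Submodule.torsionBy A⟦X⟧ N X) :=
  notMem_support_of_X_mem_annihilator (mem_annihilator_torsionBy X) fun h' ↦ h <|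
    ((Submodule.subtype _).annihilator_le_of_injective (Submodule.subtype_injective _)).trans h'

theorem notMem_support_quotSMulTop_X
    (h : ¬ Module.annihilator A⟦X⟧ N ≤ p.asIdeal.comap constantCoeff) :
    p ∉ Module.support A (QuotSMulTop (X : A⟦X⟧) N) :=
  notMem_support_of_X_mem_annihilator (QuotSMulTop.mem_annihilator N X) fun h' ↦ h <|
    ((Submodule.mkQ _).annihilator_le_of_surjective (Submodule.mkQ_surjective _)).trans h'

variable [IsNoetherianRing A]

theorem not_le_comap_constantCoeff_of_height_lt {I : Ideal A⟦X⟧} {p : Ideal A} [p.IsPrime]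
    (h : p.height + 1 < I.height) : ¬ I ≤ p.comap constantCoeff := fun hle ↦
  ((Ideal.height_mono hle).trans (height_comap_constantCoeff_le p)).not_gt h

theorem localLength_torsionBy_X_eq_of_equiv_quotient {q : PrimeSpectrum A⟦X⟧}
    (h : p.asIdeal.height + 1 ≤ q.asIdeal.height) (e : N ≃ₗ[A⟦X⟧] A⟦X⟧ ⧸ q.asIdeal) :
    localLength p (Submodule.torsionBy A⟦X⟧ N X) = localLength p (QuotSMulTop (X : A⟦X⟧) N) := by
  have hann : Module.annihilator A⟦X⟧ N = q.asIdeal := by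
    rw [e.annihilator_eq, Ideal.annihilator_quotient]
  by_cases hX : X ∈ q.asIdeal
  · have hXN : Module.IsTorsionBy A⟦X⟧ N X :=
      (Module.isTorsionBy_iff_mem_annihilator _ _).mpr (hann ▸ hX)
    have htorsion := (Module.isTorsionBy_iff_torsionBy_eq_top X).mp hXN
    have hsmul : (X : A⟦X⟧) • (⊤ : Submodule A⟦X⟧ N) = ⊥ := by
      rw [eq_bot_iff]
      rintro _ ⟨n, -, rfl⟩
      exact @hXN n
    exact (localLength_congr p ((LinearEquiv.ofTop _ htorsion).restrictScalars A)).trans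
      (localLength_congr p ((Submodule.quotEquivOfEqBot _ hsmul).restrictScalars A)).symm
  · have hcomap : ¬ Module.annihilator A⟦X⟧ N ≤ p.asIdeal.comap constantCoeff := fun hle ↦ by
      have hlt : q.asIdeal < p.asIdeal.comap constantCoeff :=
        lt_of_le_of_ne (hann ▸ hle) fun heq ↦ hX (by simp [heq])
      exact ((Ideal.height_strict_mono_of_isPrime hlt).trans_le
        (height_comap_constantCoeff_le p.asIdeal)).not_ge h
    rw [(localLength_eq_zero_iff p).mpr (notMem_support_torsionBy_X hcomap),
      (localLength_eq_zero_iff p).mpr (notMem_support_quotSMulTop_X hcomap)]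

theorem localLength_quotSMulTop_X_ne_top [Module.Finite A⟦X⟧ N]
    (h : p.asIdeal.height + 1 ≤ (Module.annihilator A⟦X⟧ N).height) :
    localLength p (QuotSMulTop (X : A⟦X⟧) N) ≠ ⊤ := by
  have := finite_quotSMulTop_X (A := A) (N := N)
  refine localLength_ne_top fun q hqp ↦ notMem_support_quotSMulTop_X
    (not_le_comap_constantCoeff_of_height_lt (lt_of_lt_of_le ?_ h))
  have hheight := Ideal.height_strict_mono_of_isPrime hqp
  exact (ENat.add_lt_add_iff_right ENat.one_ne_top).mpr hheight

theorem localLength_torsionBy_X_eq [hN : Module.Finite A⟦X⟧ N]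
    (h : p.asIdeal.height + 1 ≤ (Module.annihilator A⟦X⟧ N).height) :
    localLength p (Submodule.torsionBy A⟦X⟧ N X) = localLength p (QuotSMulTop (X : A⟦X⟧) N) := by
  revert h ‹Module A N›
  induction hN using IsNoetherianRing.induction_on_isQuotientEquivQuotientPrime A⟦X⟧ with
  | subsingleton N =>
    intro _ _ _
    rw [localLength_eq_zero_of_subsingleton, localLength_eq_zero_of_subsingleton]
  | quotient N q e =>
    intro _ _ h
    rw [e.annihilator_eq, Ideal.annihilator_quotient] at h
    exact localLength_torsionBy_X_eq_of_equiv_quotient h e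
  | exact N₁ N₂ N₃ f g hf hg hfg ih₁ ih₃ =>
    intro _ _ h
    have hN₁ := h.trans (Ideal.height_mono (f.annihilator_le_of_injective hf))
    have hN₃ := h.trans (Ideal.height_mono (g.annihilator_le_of_surjective hg))
    let _ : Module A N₁ := Module.compHom N₁ (algebraMap A A⟦X⟧)
    let _ : Module A N₃ := Module.compHom N₃ (algebraMap A A⟦X⟧)
    have : IsScalarTower A A⟦X⟧ N₁ := .of_algebraMap_smul fun _ _ ↦ rfl
    have : IsScalarTower A A⟦X⟧ N₃ := .of_algebraMap_smul fun _ _ ↦ rfl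
    have hadd := localLength_torsionBy_add_quotSMulTop p (X : A⟦X⟧) hf hg hfg
    rw [ih₁ hN₁, ih₃ hN₃, add_assoc (localLength p (Submodule.torsionBy A⟦X⟧ N₂ X)),
      add_comm (localLength p (Submodule.torsionBy A⟦X⟧ N₂ X))] at hadd
    exact (WithTop.add_left_cancel (WithTop.add_ne_top.mpr
      ⟨localLength_quotSMulTop_X_ne_top hN₁, localLength_quotSMulTop_X_ne_top hN₃⟩) hadd).symm

end EulerCharacteristic

theorem proposition2p4_general {A : Type*} [CommRing A] [IsDomain A] [IsNoetherianRing A]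
    [IsRegularInCodimOne A] {P : Type*} [AddCommGroup P] [Module A⟦X⟧ P]
    [Module A P] [IsScalarTower A A⟦X⟧ P] (hP : IsPseudoNull A⟦X⟧ P) :
    Module.Finite A (Submodule.torsionBy A⟦X⟧ P PowerSeries.X) ∧
    Module.IsTorsion A (Submodule.torsionBy A⟦X⟧ P PowerSeries.X) ∧
    Module.Finite A (P ⧸ ((PowerSeries.X : A⟦X⟧) • (⊤ : Submodule A⟦X⟧ P))) ∧
    Module.IsTorsion A (P ⧸ ((PowerSeries.X : A⟦X⟧) • (⊤ : Submodule A⟦X⟧ P))) ∧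
    charIdeal A (Submodule.torsionBy A⟦X⟧ P PowerSeries.X) =
      charIdeal A (P ⧸ ((PowerSeries.X : A⟦X⟧) • (⊤ : Submodule A⟦X⟧ P))) := by
  have := hP.finite
  have hker := finite_torsionBy_X (A := A) (N := P)
  have hcoker := finite_quotSMulTop_X (A := A) (N := P)
  have hbot : ¬ Module.annihilator A⟦X⟧ P ≤
      (⊥ : PrimeSpectrum A).asIdeal.comap PowerSeries.constantCoeff :=
    not_le_comap_constantCoeff_of_height_lt (lt_of_lt_of_le (by simp) hP.two_le_height)
  have hker_torsion := isTorsion_of_bot_notMem_support (notMem_support_torsionBy_X hbot)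
  have hcoker_torsion := isTorsion_of_bot_notMem_support (notMem_support_quotSMulTop_X hbot)
  refine ⟨hker, hker_torsion, hcoker, hcoker_torsion, ?_⟩
  rw [charIdeal_eq_finprod hker_torsion, charIdeal_eq_finprod hcoker_torsion]
  refine finprod_congr fun p ↦ ?_
  have hp : p.1.asIdeal.height + 1 ≤ (Module.annihilator A⟦X⟧ P).height := by
    rw [p.2, one_add_one_eq_two]
    exact hP.two_le_height
  rw [localLength_torsionBy_X_eq hp]

theorem proposition2p4 {A : Type*} [CommRing A] [IsDomain A] [IsNoetherianRing A]
    [IsKrullDomain A] {P : Type*} [AddCommGroup P] [Module A⟦X⟧ P]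
    [Module A P] [IsScalarTower A A⟦X⟧ P] (hP : IsPseudoNull A⟦X⟧ P) :
    Module.Finite A (Submodule.torsionBy A⟦X⟧ P PowerSeries.X) ∧
    Module.IsTorsion A (Submodule.torsionBy A⟦X⟧ P PowerSeries.X) ∧
    Module.Finite A (P ⧸ ((PowerSeries.X : A⟦X⟧) • (⊤ : Submodule A⟦X⟧ P))) ∧
    Module.IsTorsion A (P ⧸ ((PowerSeries.X : A⟦X⟧) • (⊤ : Submodule A⟦X⟧ P))) ∧
    charIdeal A (Submodule.torsionBy A⟦X⟧ P PowerSeries.X) =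
      charIdeal A (P ⧸ ((PowerSeries.X : A⟦X⟧) • (⊤ : Submodule A⟦X⟧ P))) :=
  proposition2p4_general hP
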